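/- **Setting.** A unicast index coding instance $\mathcal I=\{B_i,\ i\in[m]\}$ has $m$ users; user $i$ requests message $x_i$, $B_i\subseteq[m]\setminus\{i\}$ is its interfering message set, and $A_i=[m]\setminus(B_i\cup\{i\})$ is its side information set. A $(t,r)$ index code over an alphabet $\mathcal X$ ($t\ge 1$) consists of an encoder $\phi:(\mathcal X^{t})^{m}\to\mathcal X^{r}$ and decoders $\psi_i$ such that $\psi_i\big(\phi(x),(x_l)_{l\in A_i}\big)=x_i$ for every user $i$ and all messages $x$; its rate is $r/t$, and it is scalar if $t=1$. It is linear over $\mathbb F_q$ if $\mathcal X=\mathbb F_q$, $\phi$ is given by an $r\times mt$ matrix over $\mathbb F_q$, and all decoders are linear. The broadcast rate $\beta(\mathcal I)$ over $\mathcal X$ is the infimum of the rates of all index codes over $\mathcal X$ (over all $t\ge1$ and $r$), and $\lambda_q(\mathcal I)$ is the infimum of the rates of all linear index codes over the finite field $\mathbb F_q$. A set $M=\{i_1,\dots,i_k\}\subseteq[m]$ of $k\ge2$ distinct users is a minimal cyclic set if, for some such ordering, $B_{i_j}\cap M=M\setminus\{i_j,i_{j+1}\}$ for all $j\in[k]$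 (with $i_{k+1}=i_1$); a set is acyclic if none of its subsets is a minimal cyclic set; $\beta_{\mathrm{MAIS}}(\mathcal I)$ is the largest size of an acyclic set. Let $\mathcal I_3=\{B_i,\ i\in[58]\}$ where, with $[a:b]=\{a,\dots,b\}$ and $[8]=[1:8]$, $B_{1}=([8]\backslash\{1\})\cup \{15,16\}\cup ([19:50]\backslash \{19,27,35,43\})$, $B_{2}=([8]\backslash\{2\})\cup \{15,16\}\cup ([19:50]\backslash \{20,28,36,44\})$, $B_{3}=([8]\backslash\{3\})\cup \{13,14\}\cup ([19:50]\backslash \{21,29,37,45\})$, $B_{4}=([8]\backslash\{4\})\cup \{13,14\}\cup ([19:50]\backslash \{22,30,38,46\})$, $B_{5}=([8]\backslash\{5\})\cup \{11,12\}\cup ([19:50]\backslash \{23,31,39,47\})$, $B_{6}=([8]\backslash\{6\})\cup \{11,12\}\cup ([19:50]\backslash \{24,32,40,48\})$, $B_{7}=([8]\backslash\{7\})\cup \{9,10\} \cup ([19:50]\backslash \{25,33,41,49\})$, $B_{8}=([8]\backslash\{8\})\cup \{9,10\}\cup ([19:50]\backslash \{26,34,42,50\})$, $B_{9}=[9:16]\backslash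 \{9\}$, $B_{10}=\{9,12,14\}$, $B_{11}=[9:16]\backslash \{11\}$, $B_{12}=\{11,14,16\}$, $B_{13}=[9:16]\backslash \{13\}$, $B_{14}=\{13,10,16\}$, $B_{15}=[9:16]\backslash \{15\}$, $B_{16}=\{15,10,12\}$, $B_{17}=\{18\}$, $B_{18}=\{17\}$, $B_{19}=\{9,10,20,21,22\}$, $B_{20}=\{9,10,19,21,22\}$, $B_{21}=\{9,10,22,23,24\}$, $B_{22}=\{9,10,21,23,24\}$, $B_{23}=\{9,10,19,20,24\}$, $B_{24}=\{9,10,19,20,23\}$, $B_{25}=\{1,2,15,16,17,18,26\}$, $B_{26}=\{1,2,15,16,17,18,25\}$, $B_{27}=\{11,12,28,29,30\}$, $B_{28}=\{11,12,27,29,30\}$, $B_{29}=\{11,12,30,33,34\}$, $B_{30}=\{11,12,29,33,34\}$, $B_{31}=\{7,8,9,10,17,18,32\}$, $B_{32}=\{7,8,9,10,17,18,31\}$, $B_{33}=\{11,12,27,28,34\}$, $B_{34}=\{11,12,27,28,33\}$, $B_{35}=\{13,14,36,39,40\}$, $B_{36}=\{13,14,35,39,40\}$, $B_{37}=\{5,6,11,12,17,18,38\}$,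 $B_{38}=\{5,6,11,12,17,18,37\}$, $B_{39}=\{13,14,40,41,42\}$, $B_{40}=\{13,14,39,41,42\}$, $B_{41}=\{13,14,35,36,42\}$, $B_{42}=\{13,14,35,36,41\}$, $B_{43}=\{3,4,13,14,17,18,44\}$, $B_{44}=\{3,4,13,14,17,18,43\}$, $B_{45}=\{15,16,46,47,48\}$, $B_{46}=\{15,16,45,47,48\}$, $B_{47}=\{15,16,48,49,50\}$, $B_{48}=\{15,16,47,49,50\}$, $B_{49}=\{15,16,45,46,50\}$, $B_{50}=\{15,16,45,46,49\}$, $B_{51}=\{7,8,9,10,17,18,31,32,52\}$, $B_{52}=\{7,8,9,10,17,18,31,32,51\}$, $B_{53}=\{5,6,11,12,17,18,37,38,54\}$, $B_{54}=\{5,6,11,12,17,18,37,38,53\}$, $B_{55}=\{3,4,13,14,17,18,43,44,56\}$, $B_{56}=\{3,4,13,14,17,18,43,44,55\}$, $B_{57}=\{1,2,15,16,17,18,25,26,58\}$, $B_{58}=\{1,2,15,16,17,18,25,26,57\}$. **Theorem.** $\beta_{\mathrm{MAIS}}(\mathcal I_3)=8$, and for every finite field $\mathbb F_q$, $$\lambda_q(\mathcal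 I_3)=\beta_{\mathrm{MAIS}}(\mathcal I_3)=8\quad\Longleftrightarrow\quad \operatorname{char}\mathbb F_q\neq 3 .$$ Moreover, for every finite field $\mathbb F_q$ of characteristic three (in particular for $GF(3)$) there is a scalar index code for $\mathcal I_3$ over the alphabet $\mathbb F_q$, with $r=8$ and with an encoder that is not $\mathbb F_q$-linear, whose rate $8$ equals the broadcast rate $\beta(\mathcal I_3)$ over the alphabet $\mathbb F_q$. -/

import Mathlib

/-- A unicast index coding instance with `m` users (and `m` messages): user `i` requests message
`i`, and `interf i` is its interfering message set `B_i`, i.e. the messages other than its own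
which it does not know. -/
structure IndexInstance (m : ℕ) where
  interf : Fin m → Finset (Fin m)
  not_mem_interf : ∀ i, i ∉ interf i

namespace IndexInstance

/-- The side information set `A_i`: all messages other than `i` outside `B_i`. -/
def sideInfo {m : ℕ} (I : IndexInstance m) (i : Fin m) : Finset (Fin m) :=
  Finset.univ \ insert i (I.interf i)

/-- `M = {i_1, …, i_k}` (`k ≥ 2`, distinct elements) is a minimal cyclic set: inside `M`, the
interfering set of `i_j` is `M` minus `i_j` and its cyclic successor `i_{j+1}`. The addition on
`Fin (n + 2)` is cyclic. -/
def IsMinimalCyclic {m : ℕ} (I : IndexInstance m) (M : Finset (Fin m)) : Prop :=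
  ∃ (n : ℕ) (c : Fin (n + 2) → Fin m), Function.Injective c ∧ Finset.univ.image c = M ∧
    ∀ j, I.interf (c j) ∩ M = M \ {c j, c (j + 1)}

/-- `M` is acyclic if no subset of it is a minimal cyclic set. -/
def IsAcyclicSet {m : ℕ} (I : IndexInstance m) (M : Finset (Fin m)) : Prop :=
  ∀ M' ⊆ M, ¬ I.IsMinimalCyclic M'

open Classical in
/-- `β_MAIS`: the maximum size of an acyclic set. -/
noncomputable def betaMAIS {m : ℕ} (I : IndexInstance m) : ℕ :=
  (Finset.univ.filter fun M : Finset (Fin m) => I.IsAcyclicSet M).sup Finset.card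

end IndexInstance

/-- A (zero-error) `(t, r)` index code for `I` over the alphabet `X`. Message `i` is a word
`x i : Fin t → X`; the server broadcasts `r` symbols, and user `i` recovers `x i` from them and
from the messages in its side information set. -/
structure IndexCode {m : ℕ} (I : IndexInstance m) (X : Type*) (t r : ℕ) where
  encode : (Fin m → Fin t → X) → (Fin r → X)
  decode : (i : Fin m) → (Fin r → X) → ({l // l ∈ I.sideInfo i} → Fin t → X) → (Fin t → X)
  correct : ∀ (i : Fin m) (x : Fin m → Fin t → X),
    decode i (encode x) (fun l => x l.1) = x i

namespace IndexCode

/-- The broadcast rate `r / t` of a `(t, r)` index code. -/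
noncomputable def rate {m : ℕ} {I : IndexInstance m} {X : Type*} {t r : ℕ}
    (_C : IndexCode I X t r) : ℝ := (r : ℝ) / (t : ℝ)

/-- The encoder is given by an `r × mt` encoding matrix over `F`. -/
def HasLinearEncoder {m : ℕ} {I : IndexInstance m} {F : Type*} [Field F] {t r : ℕ}
    (C : IndexCode I F t r) : Prop :=
  ∃ H : Matrix (Fin r) (Fin m × Fin t) F,
    ∀ x, C.encode x = H.mulVec (fun p => x p.1 p.2)

/-- A linear index code over `F`: the encoder is an encoding matrix and all decoders are linear
in the pair (received word, side information). -/
def IsLinear {m : ℕ} {I : IndexInstance m} {F : Type*} [Field F] {t r : ℕ}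
    (C : IndexCode I F t r) : Prop :=
  C.HasLinearEncoder ∧
    ∀ i, IsLinearMap F
      (fun p : (Fin r → F) × ({l // l ∈ I.sideInfo i} → Fin t → F) => C.decode i p.1 p.2)

end IndexCode

namespace IndexInstance

/-- `β(I)` over the alphabet `X`: the infimum of the rates of all index codes with message
length `t ≥ 1`. -/
noncomputable def broadcastRate {m : ℕ} (I : IndexInstance m) (X : Type*) : ℝ :=
  sInf {ρ : ℝ | ∃ (t r : ℕ) (C : IndexCode I X t r), 0 < t ∧ C.rate = ρ}

/-- `λ_q(I)` over the field `F` with `q` elements: the infimum of the rates of all linear index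
codes over `F` with message length `t ≥ 1`. -/
noncomputable def linearRate {m : ℕ} (I : IndexInstance m) (F : Type*) [Field F] : ℝ :=
  sInf {ρ : ℝ | ∃ (t r : ℕ) (C : IndexCode I F t r), 0 < t ∧ C.IsLinear ∧ C.rate = ρ}

end IndexInstance

/-- The sets `B_1, …, B_58`, with users numbered from `1` to `58`. -/
def interfTable : ℕ → Finset ℕ
  | 1 => (Finset.Icc 1 8 \ {1}) ∪ {15, 16} ∪ (Finset.Icc 19 50 \ {19, 27, 35, 43})
  | 2 => (Finset.Icc 1 8 \ {2}) ∪ {15, 16} ∪ (Finset.Icc 19 50 \ {20, 28, 36, 44})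
  | 3 => (Finset.Icc 1 8 \ {3}) ∪ {13, 14} ∪ (Finset.Icc 19 50 \ {21, 29, 37, 45})
  | 4 => (Finset.Icc 1 8 \ {4}) ∪ {13, 14} ∪ (Finset.Icc 19 50 \ {22, 30, 38, 46})
  | 5 => (Finset.Icc 1 8 \ {5}) ∪ {11, 12} ∪ (Finset.Icc 19 50 \ {23, 31, 39, 47})
  | 6 => (Finset.Icc 1 8 \ {6}) ∪ {11, 12} ∪ (Finset.Icc 19 50 \ {24, 32, 40, 48})
  | 7 => (Finset.Icc 1 8 \ {7}) ∪ {9, 10} ∪ (Finset.Icc 19 50 \ {25, 33, 41, 49})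
  | 8 => (Finset.Icc 1 8 \ {8}) ∪ {9, 10} ∪ (Finset.Icc 19 50 \ {26, 34, 42, 50})
  | 9 => Finset.Icc 9 16 \ {9}
  | 10 => {9, 12, 14}
  | 11 => Finset.Icc 9 16 \ {11}
  | 12 => {11, 14, 16}
  | 13 => Finset.Icc 9 16 \ {13}
  | 14 => {13, 10, 16}
  | 15 => Finset.Icc 9 16 \ {15}
  | 16 => {15, 10, 12}
  | 17 => {18}
  | 18 => {17}
  | 19 => {9, 10, 20, 21, 22}
  | 20 => {9, 10, 19, 21, 22}
  | 21 => {9, 10, 22, 23, 24}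
  | 22 => {9, 10, 21, 23, 24}
  | 23 => {9, 10, 19, 20, 24}
  | 24 => {9, 10, 19, 20, 23}
  | 25 => {1, 2, 15, 16, 17, 18, 26}
  | 26 => {1, 2, 15, 16, 17, 18, 25}
  | 27 => {11, 12, 28, 29, 30}
  | 28 => {11, 12, 27, 29, 30}
  | 29 => {11, 12, 30, 33, 34}
  | 30 => {11, 12, 29, 33, 34}
  | 31 => {7, 8, 9, 10, 17, 18, 32}
  | 32 => {7, 8, 9, 10, 17, 18, 31}
  | 33 => {11, 12, 27, 28, 34}
  | 34 => {11, 12, 27, 28, 33}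
  | 35 => {13, 14, 36, 39, 40}
  | 36 => {13, 14, 35, 39, 40}
  | 37 => {5, 6, 11, 12, 17, 18, 38}
  | 38 => {5, 6, 11, 12, 17, 18, 37}
  | 39 => {13, 14, 40, 41, 42}
  | 40 => {13, 14, 39, 41, 42}
  | 41 => {13, 14, 35, 36, 42}
  | 42 => {13, 14, 35, 36, 41}
  | 43 => {3, 4, 13, 14, 17, 18, 44}
  | 44 => {3, 4, 13, 14, 17, 18, 43}
  | 45 => {15, 16, 46, 47, 48}
  | 46 => {15, 16, 45, 47, 48}
  | 47 => {15, 16, 48, 49, 50}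
  | 48 => {15, 16, 47, 49, 50}
  | 49 => {15, 16, 45, 46, 50}
  | 50 => {15, 16, 45, 46, 49}
  | 51 => {7, 8, 9, 10, 17, 18, 31, 32, 52}
  | 52 => {7, 8, 9, 10, 17, 18, 31, 32, 51}
  | 53 => {5, 6, 11, 12, 17, 18, 37, 38, 54}
  | 54 => {5, 6, 11, 12, 17, 18, 37, 38, 53}
  | 55 => {3, 4, 13, 14, 17, 18, 43, 44, 56}
  | 56 => {3, 4, 13, 14, 17, 18, 43, 44, 55}
  | 57 => {1, 2, 15, 16, 17, 18, 25, 26, 58}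
  | 58 => {1, 2, 15, 16, 17, 18, 25, 26, 57}
  | _ => ∅

/-- The 58-user instance; `k : Fin 58` stands for user `k + 1`. -/
def instanceI3 : IndexInstance 58 where
  interf i := Finset.univ.filter fun j : Fin 58 => (j : ℕ) + 1 ∈ interfTable ((i : ℕ) + 1)
  not_mem_interf := by decide +kernel

/-!
Call a user of a set `D` of users a sink if its side information misses `D`. A set all of whose
nonempty subsets have a sink can be read off from the broadcast word once the other messages are
fixed, so it forces `|D| t ≤ r` for every code. An acyclic set has this property, because an
inclusion-minimal nonempty set without a sink is a minimal cyclic set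
(`IndexInstance.exists_isMinimalCyclic_subset`). Hence `β_MAIS ≤ r / t` for all codes
(`IndexInstance.betaMAIS_mul_le`), while the users `1, …, 8` interfere with each other, so
`β_MAIS ≥ 8`. A single code of rate `8` over some alphabet then gives `β_MAIS = 8`.

Such a code exists over every field `F`. Consecutive messages are paired, and pairs are read as
elements of an abelian group `G` on the set `F × F`; the code broadcasts four elements of `G`, which
are `0, 1`-combinations of thirteen slots of pairs (`slotMatrix`). The users other than `9, …, 16`
decode from one broadcast element or a difference of two. In the four slots `9, …, 16` the
coefficient matrix is the all-ones matrix minus the identity, up to order; its determinant is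
`±3`. It reveals the differences of the four slots and three times each slot, so what is needed
is that `3 • g` determines the first coordinate of `g ∈ G`: the second coordinate of a slot is then
found from a difference with another slot that the user knows (`eq_of_groupEncode_eq`). If `3 ≠ 0`
in `F`, the group `G = F × F` does, and the code is linear. If `F` has characteristic three, the
Witt vectors of length two do (`WittPair.three_smul_injective_fst`), and the code is not linear
because of their carry.

A linear code in characteristic three has `41 t ≤ 5 r`, so linear rates stay at least `41 / 5`
(`LinearScheme.mul_finrank_le`). Consider four broadcast words that are all zero and share the
messages of the users `17, 18`, where the `g`-th word otherwise involves one pair of the users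
`1, …, 8`, one pair of the users `9, …, 16`, and two pairs of the users `19, …, 58` that are forced
to vanish. Counting dimensions, there are at least `34 t - 4 r` such systems of messages. In each
coordinate of the users `1, …, 8`, three of the four pairs of `9, …, 16` contribute the same vector
up to sign, namely that of the users `17, 18`, and the fourth contributes nothing; in characteristic
three the sum vanishes. So the joint contribution of the users `9, …, 16` lies in a space of
dimension `r - 8 t`, and together with the message of user `16` it determines the whole system
(`LinearScheme.system_injective`). This gives `34 t - 4 r ≤ t + (r - 8 t)`.
-/

/-! ### Acyclic sets bound the rate -/

namespace IndexInstance

variable {m : ℕ} (I : IndexInstance m)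

lemma mem_sideInfo {i j : Fin m} : j ∈ I.sideInfo i ↔ j ≠ i ∧ j ∉ I.interf i := by
  simp [sideInfo]

/-- A nonempty set of users each of which knows a message of the set contains a minimal cyclic set:
an inclusion-minimal such set is a single cycle of any choice of out-neighbours, and minimality
leaves no room for a second out-neighbour. -/
lemma exists_isMinimalCyclic_subset (D : Finset (Fin m)) (hne : D.Nonempty)
    (hout : ∀ i ∈ D, ∃ j ∈ D, j ∈ I.sideInfo i) : ∃ M ⊆ D, I.IsMinimalCyclic M := by
  induction D using Finset.strongInduction with
  | H D ih =>
  by_cases hmin : ∃ D' ⊂ D, D'.Nonempty ∧ ∀ i ∈ D', ∃ j ∈ D', j ∈ I.sideInfo i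
  · obtain ⟨D', hD', hne', hout'⟩ := hmin
    obtain ⟨M, hM, hc⟩ := ih D' hD' hne' hout'
    exact ⟨M, hM.trans hD'.subset, hc⟩
  have hfull : ∀ D' ⊆ D, D'.Nonempty → (∀ i ∈ D', ∃ j ∈ D', j ∈ I.sideInfo i) → D' = D := by
    intro D' hs hn ho
    by_contra hneq
    exact hmin ⟨D', hs.ssubset_of_ne hneq, hn, ho⟩
  choose! f hfD hfA using hout
  -- A choice of out-neighbours inside `D` is onto `D`, because its image has no sink.
  have himg : ∀ g : Fin m → Fin m, (∀ i ∈ D, g i ∈ D) → (∀ i ∈ D, g i ∈ I.sideInfo i) →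
      D.image g = D := by
    intro g hgD hgA
    refine hfull _ (Finset.image_subset_iff.2 hgD) (hne.image g) fun i hi => ?_
    obtain ⟨k, hk, rfl⟩ := Finset.mem_image.1 hi
    exact ⟨g (g k), Finset.mem_image_of_mem g (hgD k hk), hgA _ (hgD k hk)⟩
  have hinj : Set.InjOn f D := Finset.card_image_iff.1 (by rw [himg f hfD hfA])
  have huniq : ∀ i ∈ D, ∀ j ∈ D, j ∈ I.sideInfo i → j = f i := by
    intro i hi j hj hij
    -- Redirecting `f` at `i` to `j` would leave `f i` without a preimage.
    have h := himg (Function.update f i j)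
      (fun k hk => by
        rcases eq_or_ne k i with rfl | h
        · simpa using hj
        · simpa [h] using hfD k hk)
      (fun k hk => by
        rcases eq_or_ne k i with rfl | h
        · simpa using hij
        · simpa [h] using hfA k hk)
    obtain ⟨k, hk, hki⟩ := Finset.mem_image.1 (h.symm ▸ hfD i hi)
    rcases eq_or_ne k i with rfl | hne'
    · simpa using hki
    · rw [Function.update_of_ne hne'] at hki
      exact absurd (hinj hk hi hki) hne'
  obtain ⟨a, ha⟩ := hne
  have hiter : ∀ b ∈ D, ∀ k, f^[k] b ∈ D := by
    intro b hb k
    induction k with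
    | zero => exact hb
    | succ k ihk => rw [Function.iterate_succ_apply']; exact hfD _ ihk
  have horbit : ∀ b ∈ D, ∀ y ∈ D, ∃ k, f^[k] b = y := by
    classical
    intro b hb y hy
    have h := hfull (D.filter fun y => ∃ k, f^[k] b = y) (Finset.filter_subset _ _)
      ⟨b, Finset.mem_filter.2 ⟨hb, 0, rfl⟩⟩ fun i hi => by
        obtain ⟨hiD, k, rfl⟩ := Finset.mem_filter.1 hi
        exact ⟨_, Finset.mem_filter.2 ⟨hfD _ hiD, k + 1, Function.iterate_succ_apply' f k b⟩,
          hfA _ hiD⟩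
    rw [← h] at hy
    exact (Finset.mem_filter.1 hy).2
  obtain ⟨k, hk⟩ := horbit (f a) (hfD a ha) a ha
  have hpos : 0 < Function.minimalPeriod f a :=
    Function.IsPeriodicPt.minimalPeriod_pos (Nat.succ_pos k) hk
  have hone : Function.minimalPeriod f a ≠ 1 := by
    intro h
    have h1 : f a = a := Function.minimalPeriod_eq_one_iff_isFixedPt.1 h
    exact ((I.mem_sideInfo).1 (hfA a ha)).1 h1
  obtain ⟨n, hn⟩ : ∃ n, Function.minimalPeriod f a = n + 2 :=
    ⟨Function.minimalPeriod f a - 2, by omega⟩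
  refine ⟨D, subset_rfl, n, fun j => f^[j] a, ?_, ?_, ?_⟩
  · intro i j hij
    exact Fin.ext (Function.iterate_injOn_Iio_minimalPeriod (f := f) (x := a)
      (by simp [hn]) (by simp [hn]) hij)
  · ext y
    simp only [Finset.mem_image, Finset.mem_univ, true_and]
    constructor
    · rintro ⟨j, rfl⟩
      exact hiter a ha j
    · intro hy
      obtain ⟨k, rfl⟩ := horbit a ha y hy
      refine ⟨⟨k % (n + 2), Nat.mod_lt _ (by omega)⟩, ?_⟩
      simp only [← hn]
      exact Function.iterate_mod_minimalPeriod_eq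
  · intro j
    have hnext : f^[((j + 1 : Fin (n + 2)) : ℕ)] a = f (f^[(j : ℕ)] a) := by
      have h := Function.iterate_mod_minimalPeriod_eq (f := f) (x := a) (n := (j : ℕ) + 1)
      rw [hn] at h
      rw [← Function.iterate_succ_apply' f, Fin.val_add, Fin.val_one]
      exact h
    have hj := hiter a ha j
    simp only [hnext]
    ext y
    simp only [Finset.mem_inter, Finset.mem_sdiff, Finset.mem_insert, Finset.mem_singleton, not_or]
    constructor
    · rintro ⟨hyB, hyD⟩
      refine ⟨hyD, ?_, ?_⟩
      · rintro rfl
        exact I.not_mem_interf _ hyB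
      · rintro rfl
        exact ((I.mem_sideInfo).1 (hfA _ hj)).2 hyB
    · rintro ⟨hyD, hy1, hy2⟩
      refine ⟨?_, hyD⟩
      by_contra hyB
      exact hy2 (huniq _ hj y hyD ((I.mem_sideInfo).2 ⟨hy1, hyB⟩))

lemma IsAcyclicSet.mul_le {I : IndexInstance m} {M : Finset (Fin m)} (hM : I.IsAcyclicSet M)
    {X : Type*} [Finite X] [Nontrivial X] {t r : ℕ} (C : IndexCode I X t r) : M.card * t ≤ r := by
  classical
  cases nonempty_fintype X
  obtain ⟨x₀⟩ : Nonempty X := inferInstance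
  let e : (M → Fin t → X) → (Fin m → Fin t → X) := fun z i => if h : i ∈ M then z ⟨i, h⟩ else
    fun _ => x₀
  have hinj : Function.Injective fun z => C.encode (e z) := by
    intro z z' h
    by_contra hzz
    obtain ⟨i₀, hi₀⟩ : ∃ i, e z i ≠ e z' i := by
      by_contra! hall
      refine hzz (funext fun i => ?_)
      simpa [e] using hall i
    have hsub : (Finset.univ.filter fun i => e z i ≠ e z' i) ⊆ M := by
      intro i hi
      by_contra hiM
      simp [e, hiM] at hi
    -- A user with no differing message in its side information tells the two inputs apart.
    obtain ⟨N, hN, hc⟩ := I.exists_isMinimalCyclic_subset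
      (Finset.univ.filter fun i => e z i ≠ e z' i) ⟨i₀, by simpa using hi₀⟩ (by
        intro i hi
        by_contra! hside
        refine (Finset.mem_filter.1 hi).2 ?_
        rw [← C.correct i (e z), ← C.correct i (e z')]
        refine congrArg₂ _ h (funext fun l => ?_)
        by_contra hl
        exact hside l.1 (by simpa using hl) l.2)
    exact hM N (hN.trans hsub) hc
  have hcard := Fintype.card_le_of_injective _ hinj
  simp only [Fintype.card_fun, Fintype.card_fin, Fintype.card_coe, ← pow_mul] at hcard
  rw [mul_comm]
  exact (Nat.pow_le_pow_iff_right Fintype.one_lt_card).1 hcard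

lemma IsAcyclicSet.card_le_betaMAIS {I : IndexInstance m} {M : Finset (Fin m)}
    (hM : I.IsAcyclicSet M) : M.card ≤ I.betaMAIS := by
  classical
  unfold betaMAIS
  exact Finset.le_sup (f := Finset.card) (Finset.mem_filter.2 ⟨Finset.mem_univ M, hM⟩)

lemma betaMAIS_mul_le (I : IndexInstance m) {X : Type*} [Finite X] [Nontrivial X] {t r : ℕ}
    (C : IndexCode I X t r) : I.betaMAIS * t ≤ r := by
  classical
  have hne : (Finset.univ.filter fun M : Finset (Fin m) => I.IsAcyclicSet M).Nonempty := by
    refine ⟨∅, Finset.mem_filter.2 ⟨Finset.mem_univ _, ?_⟩⟩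
    rintro M hM ⟨n, c, -, hc, -⟩
    rw [Finset.subset_empty.1 hM, Finset.image_eq_empty] at hc
    exact absurd hc Finset.univ_nonempty.ne_empty
  obtain ⟨M, hM, hMeq⟩ := Finset.exists_mem_eq_sup _ hne Finset.card
  have h := (Finset.mem_filter.1 hM).2.mul_le C
  unfold betaMAIS
  rw [← hMeq] at h
  convert h using 3

lemma IsAcyclicSet.of_subset_interf {I : IndexInstance m} {M : Finset (Fin m)}
    (h : ∀ i ∈ M, ∀ j ∈ M, j ≠ i → j ∈ I.interf i) : I.IsAcyclicSet M := by
  rintro M' hM' ⟨n, c, hinj, hc, hcyc⟩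
  have hmem : ∀ j, c j ∈ M' := fun j => hc ▸ Finset.mem_image_of_mem c (Finset.mem_univ j)
  have hne : c 1 ≠ c 0 := fun h => by simpa using hinj h
  have h1 : c 1 ∈ I.interf (c 0) ∩ M' :=
    Finset.mem_inter.2 ⟨h _ (hM' (hmem 0)) _ (hM' (hmem 1)) hne, hmem 1⟩
  rw [hcyc 0] at h1
  simp at h1

end IndexInstance

/-- The users `1, …, 8` form an acyclic set. -/
lemma isAcyclicSet_firstEight : instanceI3.IsAcyclicSet (Finset.univ.filter fun i => i.1 < 8) :=
  IndexInstance.IsAcyclicSet.of_subset_interf (by decide +kernel)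

lemma eight_le_betaMAIS : 8 ≤ instanceI3.betaMAIS := by
  have h := isAcyclicSet_firstEight.card_le_betaMAIS
  rwa [show (Finset.univ.filter fun i : Fin 58 => i.1 < 8).card = 8 by decide] at h

/-! ### Linear codes in characteristic three -/

/-- The pairs of users `(7, 8), (5, 6), (3, 4), (1, 2)`, in the order that matches `mixedUser`:
the messages of group `g` of `mixedUser` interfere with group `g` of `positionUser`. -/
def positionUser : Fin 4 → Fin 2 → Fin 58 := ![![6, 7], ![4, 5], ![2, 3], ![0, 1]]

/-- The pairs of users `(9, 10), …, (15, 16)`. -/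
def mixedUser : Fin 4 → Fin 2 → Fin 58 := ![![8, 9], ![10, 11], ![12, 13], ![14, 15]]

/-- The pair of users `(17, 18)`. -/
def commonUser : Fin 2 → Fin 58 := ![16, 17]

/-- For each group `g`, the two users among `19, …, 50` that are interfered with by
`positionUser g`, `mixedUser g`, `commonUser` and each other. -/
def copyUser : Fin 4 → Fin 2 → Fin 58 := ![![30, 31], ![36, 37], ![42, 43], ![24, 25]]

/-- For each group `g`, the two users among `51, …, 58` that are interfered with by
`positionUser g`, `mixedUser g`, `commonUser`, `copyUser g` and each other. -/
def spareUser : Fin 4 → Fin 2 → Fin 58 := ![![50, 51], ![52, 53], ![54, 55], ![56, 57]]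

/-- A linear code for `instanceI3` with messages in `M` and broadcast words in `V`, reduced to what
is used of it: the contribution `enc i` of message `i` to the broadcast word, and a linear map
`dec i` which recovers message `i` and annihilates the interfering messages (the decoder of user `i`
with zero side information). -/
structure LinearScheme (F V M : Type*) [Field F] [AddCommGroup V] [Module F V] [AddCommGroup M]
    [Module F M] where
  enc : Fin 58 → M →ₗ[F] V
  dec : Fin 58 → V →ₗ[F] M
  dec_enc : ∀ i v, dec i (enc i v) = v
  dec_enc_interf : ∀ i, ∀ j ∈ instanceI3.interf i, ∀ v, dec i (enc j v) = 0

namespace LinearScheme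

variable {F V M : Type*} [Field F] [AddCommGroup V] [Module F V] [AddCommGroup M] [Module F M]
  (S : LinearScheme F V M)

/-- The joint contribution of the messages of a pair of users. -/
def pairEnc (σ : Fin 2 → Fin 58) : (Fin 2 → M) →ₗ[F] V :=
  ∑ e, (S.enc (σ e)).comp (LinearMap.proj e)

lemma pairEnc_apply (σ : Fin 2 → Fin 58) (x : Fin 2 → M) :
    S.pairEnc σ x = ∑ e, S.enc (σ e) (x e) := by
  simp [pairEnc]

lemma dec_pairEnc_eq_zero {i : Fin 58} {σ : Fin 2 → Fin 58}
    (hσ : ∀ e, σ e ∈ instanceI3.interf i) (x : Fin 2 → M) : S.dec i (S.pairEnc σ x) = 0 := by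
  simp [pairEnc_apply, S.dec_enc_interf _ _ (hσ _)]

lemma dec_pairEnc_self {σ : Fin 2 → Fin 58}
    (hσ : ∀ e e', e' ≠ e → σ e' ∈ instanceI3.interf (σ e)) (e : Fin 2) (x : Fin 2 → M) :
    S.dec (σ e) (S.pairEnc σ x) = x e := by
  rw [pairEnc_apply, map_sum, Finset.sum_eq_single e, S.dec_enc]
  · exact fun e' _ he => S.dec_enc_interf _ _ (hσ e e' he) _
  · simp

lemma dec_positionUser (g g' : Fin 4) (e : Fin 2) (x : Fin 2 → M) :
    S.dec (positionUser g e) (S.pairEnc (positionUser g') x) = if g' = g then x e else 0 := by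
  split_ifs with hg
  · subst hg
    refine S.dec_pairEnc_self ?_ e x
    revert g'; decide +kernel
  · refine S.dec_pairEnc_eq_zero ?_ x
    revert g g' e; decide +kernel

/-- The messages of the users `9, …, 16` span at least seven message dimensions: they are determined
by their joint contribution and the message of user `16`. -/
lemma mixedUser_eq_zero (w : Fin 4 → Fin 2 → M) (hw : w 3 1 = 0)
    (hsum : ∑ g, S.pairEnc (mixedUser g) (w g) = 0) : w = 0 := by
  have heven : ∀ g, w g 0 = 0 := by
    intro g
    have hself : ∀ g e, e ≠ 0 → mixedUser g e ∈ instanceI3.interf (mixedUser g 0) := by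
      decide +kernel
    have hother : ∀ g g', g' ≠ g → ∀ e, mixedUser g' e ∈ instanceI3.interf (mixedUser g 0) := by
      decide +kernel
    have h := congrArg (S.dec (mixedUser g 0)) hsum
    rw [map_sum, Finset.sum_eq_single g
      (fun g' _ hg => S.dec_pairEnc_eq_zero (hother g g' hg) _) (by simp), pairEnc_apply, map_sum,
      Finset.sum_eq_single 0 (fun e _ he => S.dec_enc_interf _ _ (hself g e he) _) (by simp),
      S.dec_enc, map_zero] at h
    exact h
  have h : S.enc 9 (w 0 1) + S.enc 11 (w 1 1) + S.enc 13 (w 2 1) = 0 := by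
    simpa [Fin.sum_univ_four, pairEnc_apply, heven, hw, mixedUser] using hsum
  have h0 : w 0 1 = 0 := by
    simpa [S.dec_enc, S.dec_enc_interf 9 11 (by decide +kernel),
      S.dec_enc_interf 9 13 (by decide +kernel)] using congrArg (S.dec 9) h
  have h1 : w 1 1 = 0 := by
    simpa [h0, S.dec_enc, S.dec_enc_interf 11 13 (by decide +kernel)] using congrArg (S.dec 11) h
  have h2 : w 2 1 = 0 := by
    simpa [h0, h1, S.dec_enc] using congrArg (S.dec 13) h
  ext g e
  fin_cases e
  · exact heven g
  · fin_cases g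
    exacts [h0, h1, h2, hw]

/-- The system whose unknowns are the common messages `z.1`, for each group the messages `z.2 g 0`,
`z.2 g 1`, `z.2 g 2`, `z.2 g 3` of the position, mixed, copy and spare users, and one more pair
`z.2 g 4` of vectors fed to the position users. -/
noncomputable def system :
    ((Fin 2 → M) × (Fin 4 → Fin 5 → Fin 2 → M)) →ₗ[F] (Fin 4 → V) × M × V where
  toFun z :=
    (fun g => S.pairEnc commonUser z.1 + S.pairEnc (positionUser g) (z.2 g 0) +
        S.pairEnc (mixedUser g) (z.2 g 1) + S.pairEnc (copyUser g) (z.2 g 2) +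
        S.pairEnc (spareUser g) (z.2 g 3),
      z.2 3 1 1,
      ∑ g, (S.pairEnc (mixedUser g) (z.2 g 1) + S.pairEnc (positionUser g) (z.2 g 4)))
  map_add' x y := by
    refine Prod.ext (funext fun g => ?_) (Prod.ext rfl ?_)
    · simp only [Prod.fst_add, Prod.snd_add, Pi.add_apply, map_add]
      abel
    · simp only [Prod.snd_add, Pi.add_apply, map_add, ← Finset.sum_add_distrib]
      exact Finset.sum_congr rfl fun g _ => by abel
  map_smul' k x := by
    refine Prod.ext (funext fun g => ?_) (Prod.ext rfl ?_)
    · simp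
    · simp [Finset.smul_sum]

/-- The pairs `z.2 g 4` are there to express that the joint contribution of the
mixed users is annihilated by the decoders of the users `1, …, 8`: adding contributions of these
users to it keeps the system injective. -/
lemma system_injective [CharP F 3] : Function.Injective S.system := by
  rw [injective_iff_map_eq_zero]
  rintro ⟨s, x⟩ hz
  have hgroup : ∀ g, S.pairEnc commonUser s + S.pairEnc (positionUser g) (x g 0) +
        S.pairEnc (mixedUser g) (x g 1) + S.pairEnc (copyUser g) (x g 2) +
        S.pairEnc (spareUser g) (x g 3) = 0 := fun g => congrFun (congrArg Prod.fst hz) g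
  have hlast : x 3 1 1 = 0 := congrArg (fun z => z.2.1) hz
  have htotal : ∑ g, S.pairEnc (mixedUser g) (x g 1) +
      ∑ g, S.pairEnc (positionUser g) (x g 4) = 0 := by
    rw [← Finset.sum_add_distrib]
    exact congrArg (fun z => z.2.2) hz
  clear hz
  have hspare : ∀ g, x g 3 = 0 := by
    have hB : ∀ g e e', commonUser e' ∈ instanceI3.interf (spareUser g e) ∧
        positionUser g e' ∈ instanceI3.interf (spareUser g e) ∧
        mixedUser g e' ∈ instanceI3.interf (spareUser g e) ∧
        copyUser g e' ∈ instanceI3.interf (spareUser g e) := by decide +kernel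
    have hB' : ∀ g e e', e' ≠ e → spareUser g e' ∈ instanceI3.interf (spareUser g e) := by
      decide +kernel
    intro g
    ext e
    have h := congrArg (S.dec (spareUser g e)) (hgroup g)
    simpa only [map_add, S.dec_pairEnc_eq_zero fun e' => (hB g e e').1,
      S.dec_pairEnc_eq_zero fun e' => (hB g e e').2.1,
      S.dec_pairEnc_eq_zero fun e' => (hB g e e').2.2.1,
      S.dec_pairEnc_eq_zero fun e' => (hB g e e').2.2.2,
      S.dec_pairEnc_self (hB' g), Pi.zero_apply, map_zero, zero_add] using h
  have hcopy : ∀ g, x g 2 = 0 := by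
    have hB : ∀ g e e', commonUser e' ∈ instanceI3.interf (copyUser g e) ∧
        positionUser g e' ∈ instanceI3.interf (copyUser g e) ∧
        mixedUser g e' ∈ instanceI3.interf (copyUser g e) := by decide +kernel
    have hB' : ∀ g e e', e' ≠ e → copyUser g e' ∈ instanceI3.interf (copyUser g e) := by
      decide +kernel
    intro g
    ext e
    have h := congrArg (S.dec (copyUser g e)) (hgroup g)
    simpa only [map_add, hspare, S.dec_pairEnc_eq_zero fun e' => (hB g e e').1,
      S.dec_pairEnc_eq_zero fun e' => (hB g e e').2.1,
      S.dec_pairEnc_eq_zero fun e' => (hB g e e').2.2,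
      S.dec_pairEnc_self (hB' g), Pi.zero_apply, map_zero, zero_add, add_zero] using h
  simp only [hspare, hcopy, map_zero, add_zero] at hgroup
  have hmixed_self : ∀ g e, S.dec (positionUser g e) (S.pairEnc (mixedUser g) (x g 1)) = 0 :=
    fun g e => S.dec_pairEnc_eq_zero (by revert g e; decide +kernel) _
  have hmixed : ∀ g e g', S.dec (positionUser g e) (S.pairEnc (mixedUser g') (x g' 1)) =
      if g' = g then 0 else -S.dec (positionUser g e) (S.pairEnc commonUser s) := by
    intro g e g'
    split_ifs with hg
    · exact hg ▸ hmixed_self g' e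
    · have h := congrArg (S.dec (positionUser g e)) (hgroup g')
      rw [map_add, map_add, dec_positionUser, if_neg hg, add_zero, map_zero] at h
      exact eq_neg_of_add_eq_zero_right h
  have hthree : ∀ v : M, v + v + v = 0 := by
    intro v
    have h3 : (3 : F) = 0 := by exact_mod_cast CharP.cast_eq_zero F 3
    have h : v + v + v = (3 : F) • v := by module
    rw [h, h3, zero_smul]
  -- Three of the four groups contribute the same vector to a coordinate; here the characteristic
  -- enters.
  have hcancel : ∀ g e, S.dec (positionUser g e) (∑ g', S.pairEnc (mixedUser g') (x g' 1)) = 0 := by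
    intro g e
    rw [map_sum, Finset.sum_congr rfl fun g' _ => hmixed g e g', Fin.sum_univ_four]
    fin_cases g <;> simpa using hthree _
  have hfree : ∀ g, x g 4 = 0 := by
    intro g
    ext e
    have h := congrArg (S.dec (positionUser g e)) htotal
    simpa [hcancel, dec_positionUser] using h
  simp only [hfree, map_zero, Finset.sum_const_zero, add_zero] at htotal
  have hmixed_zero : ∀ g, x g 1 = 0 := fun g =>
    congrFun (S.mixedUser_eq_zero (fun g => x g 1) hlast htotal) g
  simp only [hmixed_zero, map_zero, add_zero] at hgroup
  have hposition : ∀ g, x g 0 = 0 := by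
    intro g
    ext e
    obtain ⟨g', hg'⟩ := exists_ne g
    have h := congrArg (S.dec (positionUser g e)) (hgroup g)
    have h' := congrArg (S.dec (positionUser g e)) (hgroup g')
    rw [map_add, dec_positionUser, map_zero] at h h'
    rw [if_neg hg', add_zero] at h'
    simpa [h'] using h
  have hs : s = 0 := by
    ext e
    have h := congrArg (S.dec (commonUser e)) (hgroup 0)
    rwa [hposition, map_zero, add_zero, S.dec_pairEnc_self (by decide +kernel), map_zero] at h
  refine Prod.ext hs (funext fun g => funext fun k => ?_)
  fin_cases k
  exacts [hposition g, hmixed_zero g, hcopy g, hspare g, hfree g]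

lemma mul_finrank_le (S : LinearScheme F V M) [CharP F 3] [FiniteDimensional F V]
    [FiniteDimensional F M] :
    41 * Module.finrank F M ≤ 5 * Module.finrank F V := by
  have h := LinearMap.finrank_le_finrank_of_injective S.system_injective
  simp only [Module.finrank_prod, Module.finrank_pi_fintype, Finset.sum_const, Finset.card_univ,
    Fintype.card_fin, smul_eq_mul] at h
  omega

end LinearScheme

lemma IndexCode.HasLinearEncoder.exists_linearMap {m : ℕ} {I : IndexInstance m} {F : Type*}
    [Field F] {t r : ℕ} {C : IndexCode I F t r} (hC : C.HasLinearEncoder) :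
    ∃ L : (Fin m → Fin t → F) →ₗ[F] (Fin r → F), ∀ x, C.encode x = L x := by
  obtain ⟨H, hH⟩ := hC
  exact ⟨H.mulVecLin.comp (LinearMap.pi fun q : Fin m × Fin t =>
    (LinearMap.proj q.2 : (Fin t → F) →ₗ[F] F).comp (LinearMap.proj q.1)), hH⟩

/-- The linear scheme of a linear code. -/
lemma IndexCode.IsLinear.exists_linearScheme {F : Type*} [Field F] {t r : ℕ}
    {C : IndexCode instanceI3 F t r} (hC : C.IsLinear) :
    Nonempty (LinearScheme F (Fin r → F) (Fin t → F)) := by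
  obtain ⟨henc, hdec⟩ := hC
  obtain ⟨L, hL⟩ := henc.exists_linearMap
  have hcor : ∀ i j v, j ∉ instanceI3.sideInfo i →
      C.decode i (L (Pi.single j v)) 0 = (Pi.single j v : Fin 58 → Fin t → F) i := by
    intro i j v hj
    rw [← hL, ← C.correct i (Pi.single j v)]
    congr 1
    ext l : 1
    rw [Pi.single_eq_of_ne]
    · rfl
    · rintro h
      exact hj (h ▸ l.2)
  refine ⟨⟨fun j => L.comp (LinearMap.single F (fun _ => Fin t → F) j),
    fun i => (IsLinearMap.mk' _ (hdec i)).comp (LinearMap.inl F _ _), ?_, ?_⟩⟩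
  · intro i v
    have h := hcor i i v (by simp [IndexInstance.sideInfo])
    rwa [Pi.single_eq_same] at h
  · intro i j hj v
    have h := hcor i j v (by simp [IndexInstance.sideInfo, hj])
    rwa [Pi.single_eq_of_ne] at h
    rintro rfl
    exact instanceI3.not_mem_interf _ hj

lemma linearRate_ne_eight (F : Type*) [Field F] [CharP F 3] : instanceI3.linearRate F ≠ 8 := by
  unfold IndexInstance.linearRate
  intro h
  have hne : ({ρ : ℝ | ∃ (t r : ℕ) (C : IndexCode instanceI3 F t r),
      0 < t ∧ C.IsLinear ∧ C.rate = ρ}).Nonempty := by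
    by_contra hne
    rw [Set.not_nonempty_iff_eq_empty.1 hne, Real.sInf_empty] at h
    norm_num at h
  have h' : (41 / 5 : ℝ) ≤ 8 := by
    refine h ▸ le_csInf hne ?_
    rintro ρ ⟨t, r, C, ht, hC, rfl⟩
    obtain ⟨S⟩ := hC.exists_linearScheme
    have hle := S.mul_finrank_le
    simp only [Module.finrank_fin_fun] at hle
    have ht' : (0 : ℝ) < t := by exact_mod_cast ht
    rw [IndexCode.rate, div_le_div_iff₀ (by norm_num) ht']
    have : (41 * t : ℝ) ≤ 5 * r := by exact_mod_cast hle
    linarith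
  norm_num at h'

/-! ### A code of rate eight from an abelian group -/

/-- The encoder adds up the messages within each of thirteen slots, separately for the two users
`2k + 1`, `2k + 2` of a pair. Slots `0` to `3` collect the users `1, …, 8` and the four copies
`19, …, 50` of them, slots `4` to `7` hold the pairs `9, …, 16`, slot `8` the pair `(17, 18)`, and
slots `9` to `12` the pairs `51, …, 58`. -/
def userSlot (j : Fin 58) : Fin 13 :=
  if j.1 < 18 then Fin.ofNat 13 (j.1 / 2)
  else if j.1 < 50 then Fin.ofNat 13 ((j.1 - 18) % 8 / 2)
  else Fin.ofNat 13 (9 + (j.1 - 50) / 2)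

/-- Row `k` gives the `k`-th broadcast group element as a combination of the thirteen slots. The
block of columns `4` to `7` is, up to the order of its rows, the `4 × 4` matrix with zeros on the
diagonal and ones elsewhere, of determinant `±3`. -/
def slotMatrix : Fin 4 → Fin 13 → ℤ :=
  ![![1, 0, 0, 0, 1, 1, 1, 0, 1, 1, 1, 0, 0],
    ![0, 1, 0, 0, 1, 1, 0, 1, 1, 0, 0, 0, 1],
    ![0, 0, 1, 0, 1, 0, 1, 1, 1, 0, 0, 1, 0],
    ![0, 0, 0, 1, 0, 1, 1, 1, 1, 0, 0, 0, 0]]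

/-- The integer combination of the four broadcast group elements from which user `i` decodes. The
two users of a pair use the same one, except among the users `9, …, 16`. -/
def decodeCoeff (i : Fin 58) : Fin 4 → ℤ :=
  if i.1 % 2 = 1 ∧ 9 ≤ i.1 ∧ i.1 ≤ 15 then
    (![![1, 0, 0, -1], ![0, 0, -1, 1], ![0, -1, 1, 0], ![-1, 1, 0, 0]] :
      Fin 4 → Fin 4 → ℤ) (Fin.ofNat 4 ((i.1 - 8) / 2))
  else
    (![![1, 0, 0, 0], ![0, 1, 0, 0], ![0, 0, 1, 0], ![0, 0, 0, 1],
      ![1, 1, 1, -2], ![1, 1, -2, 1], ![1, -2, 1, 1], ![-2, 1, 1, 1],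
      ![1, 0, 0, 0],
      ![1, 0, -1, 0], ![-1, 1, 0, 0], ![0, -1, 1, 0], ![0, -1, 0, 1],
      ![1, 0, 0, -1], ![-1, 1, 0, 0], ![-1, 0, 1, 0], ![0, -1, 0, 1],
      ![1, 0, 0, -1], ![-1, 1, 0, 0], ![-1, 0, 1, 0], ![0, 0, -1, 1],
      ![1, 0, -1, 0], ![0, 1, 0, -1], ![0, -1, 1, 0], ![0, 0, -1, 1],
      ![1, -1, 0, 0], ![1, 0, 0, -1], ![0, 0, 1, -1], ![0, 1, -1, 0]] :
      Fin 29 → Fin 4 → ℤ) (Fin.ofNat 29 (i.1 / 2))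

/-- The coefficient of slot `s` in the combination used by user `i`. -/
def netCoeff (i : Fin 58) (s : Fin 13) : ℤ := ∑ k, decodeCoeff i k * slotMatrix k s

/-- The interference of user `i` is confined to slots that cancel in its combination and to the
other coordinate of its own slot. -/
lemma netCoeff_eq_zero_of_mem_interf : ∀ i : Fin 58, ∀ j ∈ instanceI3.interf i,
    (userSlot j = userSlot i → j.1 % 2 ≠ i.1 % 2) ∧
    (userSlot j ≠ userSlot i → netCoeff i (userSlot j) = 0) := by
  decide +kernel

/-- The coefficient `3` occurs for the users `9`, `11`, `13` and `15`. -/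
lemma netCoeff_userSlot : ∀ i : Fin 58,
    netCoeff i (userSlot i) = 1 ∨ (netCoeff i (userSlot i) = 3 ∧ i.1 % 2 = 0) := by
  decide +kernel

section GroupCode

variable {F G : Type*} [AddCommGroup F] [AddCommGroup G]

/-- The sum of the messages of parity `e` in slot `s`. -/
def slotSum (x : Fin 58 → F) (s : Fin 13) (e : ℕ) : F :=
  ∑ j with userSlot j = s ∧ j.1 % 2 = e, x j

/-- The `k`-th broadcast group element, where pairs of messages are read as elements of `G`. -/
def groupWord (ι : F × F ≃ G) (x : Fin 58 → F) (k : Fin 4) : G :=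
  ∑ s, slotMatrix k s • ι (slotSum x s 0, slotSum x s 1)

/-- The broadcast word, written in the alphabet `F`. -/
def groupEncode (ι : F × F ≃ G) (x : Fin 58 → F) (n : Fin 8) : F :=
  if n.1 % 2 = 0 then (ι.symm (groupWord ι x (Fin.ofNat 4 (n.1 / 2)))).1
  else (ι.symm (groupWord ι x (Fin.ofNat 4 (n.1 / 2)))).2

lemma groupWord_eq_of_groupEncode_eq {ι : F × F ≃ G} {x x' : Fin 58 → F}
    (h : groupEncode ι x = groupEncode ι x') (k : Fin 4) : groupWord ι x k = groupWord ι x' k := by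
  have hk := k.2
  have h0 := congrFun h ⟨2 * k, by omega⟩
  have h1 := congrFun h ⟨2 * k + 1, by omega⟩
  have e1 : (2 * (k : ℕ) + 1) / 2 = k := by omega
  simp only [groupEncode, Nat.mul_mod_right, Nat.mul_add_mod_self_left, Nat.one_mod,
    one_ne_zero, if_true, if_false, Nat.mul_div_cancel_left _ two_pos, e1, Fin.ofNat_eq_cast,
    Fin.cast_val_eq_self] at h0 h1
  exact ι.symm.injective (Prod.ext h0 h1)

lemma sum_decodeCoeff_smul_groupWord (ι : F × F ≃ G) (x : Fin 58 → F) (i : Fin 58) :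
    ∑ k, decodeCoeff i k • groupWord ι x k =
      ∑ s, netCoeff i s • ι (slotSum x s 0, slotSum x s 1) := by
  simp only [groupWord, netCoeff, Finset.smul_sum, Finset.sum_smul, mul_smul]
  exact Finset.sum_comm

/-- Inputs with the same broadcast word and the same side information of user `i` agree at `i`. -/
lemma eq_of_groupEncode_eq {ι : F × F ≃ G}
    (hι : ∀ a b : F × F, (3 : ℤ) • ι a = (3 : ℤ) • ι b → a.1 = b.1)
    {x x' : Fin 58 → F} (henc : groupEncode ι x = groupEncode ι x') (i : Fin 58)
    (hside : ∀ j ∈ instanceI3.sideInfo i, x j = x' j) : x i = x' i := by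
  have hside' : ∀ j, j ≠ i → j ∉ instanceI3.interf i → x j = x' j := fun j h1 h2 =>
    hside j (instanceI3.mem_sideInfo.2 ⟨h1, h2⟩)
  have hsum := sum_decodeCoeff_smul_groupWord ι x i
  simp only [groupWord_eq_of_groupEncode_eq henc] at hsum
  rw [sum_decodeCoeff_smul_groupWord ι x' i, ← sub_eq_zero, ← Finset.sum_sub_distrib,
    Finset.sum_eq_single (userSlot i) ?_ (by simp), sub_eq_zero] at hsum
  · have hslot : slotSum x' (userSlot i) (i.1 % 2) = slotSum x (userSlot i) (i.1 % 2) := by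
      rcases netCoeff_userSlot i with h1 | ⟨h3, h0⟩
      · rw [h1, one_smul, one_smul] at hsum
        have hpair := ι.injective hsum
        rcases Nat.mod_two_eq_zero_or_one i.1 with h | h <;> rw [h]
        · exact congrArg Prod.fst hpair
        · exact congrArg Prod.snd hpair
      · rw [h3] at hsum
        rw [h0]
        exact hι _ _ hsum
    rw [slotSum, slotSum, ← Finset.add_sum_erase _ _
      (by simp : i ∈ Finset.univ.filter fun j => userSlot j = userSlot i ∧ j.1 % 2 = i.1 % 2),
      ← Finset.add_sum_erase _ x
      (by simp : i ∈ Finset.univ.filter fun j => userSlot j = userSlot i ∧ j.1 % 2 = i.1 % 2)]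
      at hslot
    refine (add_right_cancel (hslot.trans (congrArg _ (Finset.sum_congr rfl fun j hj => ?_)))).symm
    simp only [Finset.mem_erase, Finset.mem_filter, Finset.mem_univ, true_and] at hj
    exact hside' j hj.1 fun hB => (netCoeff_eq_zero_of_mem_interf i j hB).1 hj.2.1 hj.2.2
  · intro s _ hs
    by_cases h0 : netCoeff i s = 0
    · simp [h0]
    have heq : ∀ e, slotSum x' s e = slotSum x s e := by
      intro e
      refine Finset.sum_congr rfl fun j hj => ?_
      simp only [Finset.mem_filter, Finset.mem_univ, true_and] at hj
      refine (hside' j ?_ fun hB => ?_).symm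
      · rintro rfl
        exact hs hj.1.symm
      · exact h0 (hj.1 ▸ (netCoeff_eq_zero_of_mem_interf i j hB).2 (hj.1 ▸ hs))
    rw [heq, heq, sub_self]

end GroupCode

/-! ### The linear code outside characteristic three -/

/-- A linear encoder from which every user can decode comes with linear decoders: user `i` can
decode as soon as an input that vanishes on its side information and has zero broadcast word
vanishes at `i`. -/
lemma IndexCode.exists_isLinear {m : ℕ} {I : IndexInstance m} {F : Type*} [Field F] {t r : ℕ}
    (L : (Fin m → Fin t → F) →ₗ[F] (Fin r → F))
    (hL : ∀ i x, L x = 0 → (∀ l ∈ I.sideInfo i, x l = 0) → x i = 0) :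
    ∃ C : IndexCode I F t r, C.IsLinear := by
  classical
  let P : ∀ i, (Fin m → Fin t → F) →ₗ[F] (Fin r → F) × ({l // l ∈ I.sideInfo i} → Fin t → F) :=
    fun i => L.prod (LinearMap.pi fun l => LinearMap.proj l.1)
  have hfac : ∀ i, ∃ D : (Fin r → F) × ({l // l ∈ I.sideInfo i} → Fin t → F) →ₗ[F] (Fin t → F),
      ∀ x, D (P i x) = x i := by
    intro i
    have hker : LinearMap.ker (P i) ≤ LinearMap.ker (LinearMap.proj i) := fun x hx =>
      hL i x (congrArg Prod.fst hx) fun l hl => congrFun (congrArg Prod.snd hx) ⟨l, hl⟩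
    obtain ⟨R, hR⟩ := LinearMap.exists_leftInverse_of_injective
      ((LinearMap.ker (P i)).liftQ (P i) le_rfl)
      (Submodule.ker_liftQ_eq_bot' _ _ rfl)
    refine ⟨((LinearMap.ker (P i)).liftQ _ hker).comp R, fun x => ?_⟩
    have hx : R (P i x) = (LinearMap.ker (P i)).mkQ x :=
      LinearMap.congr_fun hR ((LinearMap.ker (P i)).mkQ x)
    rw [LinearMap.comp_apply, hx]
    exact Submodule.liftQ_apply _ _ x
  choose D hD using hfac
  refine ⟨⟨L, fun i y z => D i (y, z), fun i x => hD i x⟩, ⟨LinearMap.toMatrix'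
    (L.comp (LinearMap.pi fun a => LinearMap.pi fun b =>
      (LinearMap.proj (a, b) : (Fin m × Fin t → F) →ₗ[F] F))), fun x => ?_⟩,
    fun i => (D i).isLinear⟩
  rw [← Matrix.toLin'_apply, Matrix.toLin'_toMatrix']
  rfl

lemma exists_isLinear_eight (F : Type*) [Field F] (h3 : (3 : F) ≠ 0) :
    ∃ C : IndexCode instanceI3 F 1 8, C.IsLinear := by
  have hadd : ∀ (x y : Fin 58 → F) s e, slotSum (x + y) s e = slotSum x s e + slotSum y s e :=
    fun x y s e => Finset.sum_add_distrib
  have hsmul : ∀ (c : F) (x : Fin 58 → F) s e, slotSum (c • x) s e = c * slotSum x s e :=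
    fun c x s e => (Finset.mul_sum _ _ _).symm
  have hwadd : ∀ (x y : Fin 58 → F) k, groupWord (Equiv.refl _) (x + y) k =
      groupWord (Equiv.refl _) x k + groupWord (Equiv.refl _) y k := by
    intro x y k
    simp only [groupWord, hadd, Equiv.refl_apply, ← Finset.sum_add_distrib, ← smul_add,
      Prod.mk_add_mk]
  have hwsmul : ∀ (c : F) (x : Fin 58 → F) k, groupWord (Equiv.refl _) (c • x) k =
      c • groupWord (Equiv.refl _) x k := by
    intro c x k
    simp only [groupWord, hsmul, Equiv.refl_apply, Finset.smul_sum, smul_comm c, Prod.smul_mk,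
      smul_eq_mul]
  let L : (Fin 58 → F) →ₗ[F] (Fin 8 → F) :=
    { toFun := groupEncode (Equiv.refl (F × F))
      map_add' := by
        intro x y
        ext n
        simp only [groupEncode, hwadd, Pi.add_apply]
        split_ifs <;> rfl
      map_smul' := by
        intro c x
        ext n
        simp only [groupEncode, hwsmul, Pi.smul_apply]
        split_ifs <;> rfl }
  refine IndexCode.exists_isLinear
    (L.comp (LinearMap.pi fun i =>
      (LinearMap.proj 0 : (Fin 1 → F) →ₗ[F] F).comp (LinearMap.proj i))) fun i x hx hl => ?_
  ext a
  rw [Subsingleton.elim a 0]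
  refine eq_of_groupEncode_eq (ι := Equiv.refl (F × F)) (x := fun j => x j 0) (x' := 0) ?_ ?_ i
    fun j hj => congrFun (hl j hj) 0
  · intro p q hpq
    have h := congrArg Prod.fst hpq
    simpa [h3] using h
  · exact hx.trans (map_zero L).symm

/-! ### The nonlinear code in characteristic three -/

/-- Pairs over a ring with the addition of Witt vectors of length two at the prime `3`; over
`GF(3)` this is a copy of `ℤ/9`. -/
@[ext]
structure WittPair (R : Type*) where
  fst : R
  snd : R

namespace WittPair

variable {R : Type*} [CommRing R]

/-- The correction term is the polynomial `(a³ + b³ - (a + b)³) / 3`. -/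
instance : Add (WittPair R) :=
  ⟨fun p q => ⟨p.fst + q.fst, p.snd + q.snd - (p.fst ^ 2 * q.fst + p.fst * q.fst ^ 2)⟩⟩

instance : Zero (WittPair R) := ⟨⟨0, 0⟩⟩

instance : Neg (WittPair R) := ⟨fun p => ⟨-p.fst, -p.snd⟩⟩

@[simp] lemma add_fst (p q : WittPair R) : (p + q).fst = p.fst + q.fst := rfl

@[simp] lemma add_snd (p q : WittPair R) :
    (p + q).snd = p.snd + q.snd - (p.fst ^ 2 * q.fst + p.fst * q.fst ^ 2) := rfl

@[simp] lemma zero_fst : (0 : WittPair R).fst = 0 := rfl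

@[simp] lemma zero_snd : (0 : WittPair R).snd = 0 := rfl

@[simp] lemma neg_fst (p : WittPair R) : (-p).fst = -p.fst := rfl

@[simp] lemma neg_snd (p : WittPair R) : (-p).snd = -p.snd := rfl

instance : AddCommGroup (WittPair R) where
  add_assoc p q r := by ext <;> simp <;> ring
  zero_add p := by ext <;> simp
  add_zero p := by ext <;> simp
  neg_add_cancel p := by ext <;> simp; ring
  add_comm p q := by ext <;> simp <;> ring
  nsmul := nsmulRec
  zsmul := zsmulRec

/-- The underlying set of `WittPair R` is `R × R`. -/
def ofProd (R : Type*) : R × R ≃ WittPair R where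
  toFun p := ⟨p.1, p.2⟩
  invFun p := (p.fst, p.snd)
  left_inv _ := rfl
  right_inv _ := rfl

/-- In characteristic three, `3 • (a, b) = (0, a³)`. -/
lemma three_smul_injective_fst [IsDomain R] [CharP R 3] {p q : WittPair R}
    (h : (3 : ℤ) • p = (3 : ℤ) • q) : p.fst = q.fst := by
  have h3 : (3 : R) = 0 := by exact_mod_cast CharP.cast_eq_zero R 3
  have hsmul : ∀ p : WittPair R, ((3 : ℤ) • p).snd = p.fst ^ 3 := by
    intro p
    rw [show (3 : ℤ) • p = p + p + p by abel]
    simp only [add_snd, add_fst]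
    linear_combination (p.snd - 3 * p.fst ^ 3) * h3
  have hcube : p.fst ^ 3 = q.fst ^ 3 := by rw [← hsmul, ← hsmul, h]
  have : Fact (Nat.Prime 3) := ⟨Nat.prime_three⟩
  exact frobenius_inj R 3 hcube

end WittPair

lemma exists_not_hasLinearEncoder (F : Type*) [Field F] [CharP F 3] :
    ∃ C : IndexCode instanceI3 F 1 8, ¬ C.HasLinearEncoder := by
  classical
  let enc : (Fin 58 → Fin 1 → F) → Fin 8 → F := fun x =>
    groupEncode (WittPair.ofProd F) fun j => x j 0
  let dec : (i : Fin 58) → (Fin 8 → F) → ({l // l ∈ instanceI3.sideInfo i} → Fin 1 → F) →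
      Fin 1 → F := fun i y z =>
    if h : ∃ x, enc x = y ∧ (fun l : {l // l ∈ instanceI3.sideInfo i} => x l.1) = z then
      h.choose i else 0
  refine ⟨⟨enc, dec, fun i x => ?_⟩, ?_⟩
  · have hex : ∃ x', enc x' = enc x ∧ (fun l : {l // l ∈ instanceI3.sideInfo i} => x' l.1) =
        fun l => x l.1 := ⟨x, rfl, rfl⟩
    simp only [dec, dif_pos hex]
    obtain ⟨h1, h2⟩ := hex.choose_spec
    ext a
    rw [Subsingleton.elim a 0]
    exact eq_of_groupEncode_eq (fun p q h => WittPair.three_smul_injective_fst h) h1 i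
      fun j hj => congrFun (congrFun h2 ⟨j, hj⟩) 0
  · intro hlin
    obtain ⟨L, hL⟩ := hlin.exists_linearMap
    -- Messages `1` and `9` both equal to one produce a carry in the first group element.
    have hadd : ∀ x y, enc (x + y) = enc x + enc y := by
      intro x y
      rw [show enc = L from funext hL, map_add]
    have hsingle : ∀ (i : Fin 58) s e,
        slotSum (fun j => (Pi.single i 1 : Fin 58 → Fin 1 → F) j 0) s e =
          if userSlot i = s ∧ i.1 % 2 = e then 1 else 0 := by
      intro i s e
      simp only [slotSum, Finset.sum_filter]
      rw [Finset.sum_eq_single i]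
      · simp
      · intro j _ hj
        simp [hj]
      · simp
    have hpair : ∀ (i i' : Fin 58) s e,
        slotSum (fun j => (Pi.single i 1 : Fin 58 → Fin 1 → F) j 0 +
          (Pi.single i' 1 : Fin 58 → Fin 1 → F) j 0) s e =
        (if userSlot i = s ∧ i.1 % 2 = e then 1 else 0) +
          if userSlot i' = s ∧ i'.1 % 2 = e then 1 else 0 := by
      intro i i' s e
      rw [← hsingle, ← hsingle]
      exact Finset.sum_add_distrib
    have h := congrFun (hadd (Pi.single 0 1) (Pi.single 8 1)) 1
    -- Users `1` and `9` have indices `0` and `8`, and position `1` of the word is the second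
    -- coordinate of the first group element.
    have h0 : userSlot 0 = 0 := by decide
    have h8 : userSlot 8 = 4 := by decide
    simp [enc, groupEncode, groupWord, hsingle, hpair, Fin.sum_univ_succ, slotMatrix, h0, h8,
      WittPair.ofProd] at h
    have h3 : (3 : F) = 0 := by exact_mod_cast CharP.cast_eq_zero F 3
    exact one_ne_zero (α := F) (by linear_combination h3 + h)

theorem theorem3 (F : Type*) [Field F] [Finite F] :
    instanceI3.betaMAIS = 8 ∧
    ((instanceI3.linearRate F = (instanceI3.betaMAIS : ℝ) ∧ (instanceI3.betaMAIS : ℝ) = 8) ↔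
      ¬ CharP F 3) ∧
    (CharP F 3 → ∃ C : IndexCode instanceI3 F 1 8,
      ¬ C.HasLinearEncoder ∧ C.rate = 8 ∧ C.rate = instanceI3.broadcastRate F) := by
  have hcode : ∀ C : IndexCode instanceI3 F 1 8, C.rate = 8 := fun C => by simp [IndexCode.rate]
  have hthree : (3 : F) = 0 → CharP F 3 := fun h =>
    (CharP.charP_iff_prime_eq_zero Nat.prime_three).2 (by exact_mod_cast h)
  have hbeta : instanceI3.betaMAIS = 8 := by
    refine le_antisymm ?_ eight_le_betaMAIS
    obtain ⟨C⟩ : Nonempty (IndexCode instanceI3 F 1 8) := by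
      by_cases h : CharP F 3
      · exact ⟨(exists_not_hasLinearEncoder F).choose⟩
      · exact ⟨(exists_isLinear_eight F fun h3 => h (hthree h3)).choose⟩
    simpa using instanceI3.betaMAIS_mul_le C
  have hle : ∀ {t r : ℕ} (C : IndexCode instanceI3 F t r), 0 < t → 8 ≤ C.rate := by
    intro t r C ht
    rw [IndexCode.rate, le_div_iff₀ (by exact_mod_cast ht)]
    exact_mod_cast hbeta ▸ instanceI3.betaMAIS_mul_le C
  refine ⟨hbeta, ?_, ?_⟩
  · rw [hbeta]
    constructor
    · rintro ⟨h, -⟩ hF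
      exact linearRate_ne_eight F (by simpa using h)
    · intro hF
      obtain ⟨C, hC⟩ := exists_isLinear_eight F fun h3 => hF (hthree h3)
      refine ⟨?_, by norm_num⟩
      have hleast : IsLeast {ρ : ℝ | ∃ (t r : ℕ) (C : IndexCode instanceI3 F t r),
          0 < t ∧ C.IsLinear ∧ C.rate = ρ} 8 := by
        refine ⟨⟨1, 8, C, one_pos, hC, hcode C⟩, ?_⟩
        rintro ρ ⟨t, r, C, ht, -, rfl⟩
        exact hle C ht
      exact hleast.csInf_eq.trans (by norm_num)
  · intro hF
    obtain ⟨C, hC⟩ := exists_not_hasLinearEncoder F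
    refine ⟨C, hC, hcode C, ?_⟩
    have hleast : IsLeast {ρ : ℝ | ∃ (t r : ℕ) (C : IndexCode instanceI3 F t r),
        0 < t ∧ C.rate = ρ} 8 := by
      refine ⟨⟨1, 8, C, one_pos, hcode C⟩, ?_⟩
      rintro ρ ⟨t, r, C, ht, rfl⟩
      exact hle C ht
    rw [hcode C]
    exact hleast.csInf_eq.symm
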